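/- Let $E$ be a real inner product space with inner product $\langle\cdot,\cdot\rangle$, norm $\|\cdot\|$ and dual norm $\|d\|_* = \sup_{\|y\|\le 1}\langle d,y\rangle$. Let $D\subset E$ be a polytope (the convex hull of a finite set of points) with vertex set $\mathcal V$. Let $f:E\to\mathbb R$ be differentiable at every point of $D$ and $\mu$-strongly convex over $D$ with respect to $\|\cdot\|$, for some $\mu\ge 0$ (for $\mu=0$ this means convex on $D$). Write $\langle\nabla f(x),v\rangle$ for the derivative of $f$ at $x$ in the direction $v$. For a polytope $K$ and $x\in K$, let $\mathcal S_x(K)$ be the family of finite sets $S$ of vertices of $K$ such that $x$ is a convex combination, with all coefficients nonzero, of all the elements of $S$. *Geometric strong convexity constant.* For $x\in D$ let $s_f(x)\in\arg\min_{v\in\mathcal V}\langle\nabla f(x),v\rangle$; for $S\in\mathcal S_x(D)$ let $v_S(x)\in\arg\max_{v\in S}\langle\nabla f(x),v\rangle$; and let $v_f(x)$ be a minimizer of $\langle\nabla f(x),v\rangle$ over all $v=v_S(x)$ with $S\in\mathcal S_x(D)$. Put $$\gamma^{A}(x,x^*):=\frac{\langle\nabla f(x),x^*-x\rangle}{\langle\nabla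 f(x),s_f(x)-v_f(x)\rangle},\qquad \mu_f^{A}:=\inf_{\substack{x,x^*\in D\\ \langle\nabla f(x),x^*-x\rangle<0}}\frac{2}{\gamma^{A}(x,x^*)^2}\bigl(f(x^*)-f(x)-\langle\nabla f(x),x^*-x\rangle\bigr),$$ which does not depend on the choice of the minimizers and maximizers. *Pyramidal width.* For a finite nonempty set $T$ and $d\neq 0$ let $\mathrm{dirW}(T,d):=\max_{y\in T}\langle d/\|d\|_*,y\rangle-\min_{y\in T}\langle d/\|d\|_*,y\rangle$. For a polytope $K$, $x\in K$ and $d\ne0$ let $$\mathrm{PdirW}(K,d,x):=\min_{S\in\mathcal S_x(K)}\mathrm{dirW}\bigl(S\cup\{s(K,d)\},d\bigr),\qquad s(K,d)\in\arg\max_{y\in K}\langle d,y\rangle,$$ and $$\mathrm{PdirW}(D):=\inf_{K,\,x,\,d}\mathrm{PdirW}(K,d,x),$$ the infimum being over all nonempty faces $K$ of $D$ (including $D$ itself), all $x\in K$ and all $d\in\mathrm{cone}(K-x)\setminus\{0\}$. Both infima are taken in the extended reals, with $\inf\emptyset=+\infty$ and $0\cdot(+\infty)=0$. Then $$\mu_f^{A}\;\ge\;\mu\cdot\mathrm{PdirW}(D)^2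 .$$ -/

import Mathlib

namespace FrankWolfe

/-- A polytope: the convex hull of a finite set of points. -/
def IsPolytope {E : Type*} [AddCommGroup E] [Module ℝ E] (D : Set E) : Prop :=
  ∃ F : Finset E, D = convexHull ℝ (F : Set E)

/-- The family of possible active sets at `x`: the finite sets `S` of vertices (extreme points) of
`D` such that `x` is a convex combination, with all coefficients nonzero, of all the elements
of `S`. -/
def activeSets {E : Type*} [AddCommGroup E] [Module ℝ E] (D : Set E) (x : E) : Set (Finset E) :=
  {S | (S : Set E) ⊆ D.extremePoints ℝ ∧
    ∃ w : E → ℝ, (∀ v ∈ S, 0 < w v) ∧ ∑ v ∈ S, w v = 1 ∧ ∑ v ∈ S, w v • v = x}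

section StrongConvexityConstant

variable {E : Type*} [NormedAddCommGroup E] [NormedSpace ℝ E]

/-- `s` is a minimizer of `⟨∇f(x), ·⟩` over the vertices of `D`, where the pairing
`⟨∇f(x), v⟩` is the derivative of `f` at `x` applied to `v`. -/
def IsTowardsVertex (f : E → ℝ) (D : Set E) (x s : E) : Prop :=
  s ∈ D.extremePoints ℝ ∧ ∀ v ∈ D.extremePoints ℝ, fderiv ℝ f x s ≤ fderiv ℝ f x v

/-- `v` is a maximizer of `⟨∇f(x), ·⟩` over the set `S`. -/
def IsAwayVertexOf (f : E → ℝ) (x : E) (S : Finset E) (v : E) : Prop :=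
  v ∈ S ∧ ∀ u ∈ S, fderiv ℝ f x u ≤ fderiv ℝ f x v

/-- `v` is a worst-case away vertex at `x`: among the away vertices of all the possible active sets
at `x`, it has the smallest value of `⟨∇f(x), ·⟩`. -/
def IsWorstAwayVertex (f : E → ℝ) (D : Set E) (x v : E) : Prop :=
  (∃ S ∈ activeSets D x, IsAwayVertexOf f x S v) ∧
    ∀ S ∈ activeSets D x, ∀ u, IsAwayVertexOf f x S u → fderiv ℝ f x v ≤ fderiv ℝ f x u

/-- The step size `⟨∇f(x), x' - x⟩ / ⟨∇f(x), s - v⟩`. -/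
noncomputable def awayStep (f : E → ℝ) (x x' s v : E) : ℝ :=
  fderiv ℝ f x (x' - x) / fderiv ℝ f x (s - v)

/-- The geometric strong convexity constant of `f` over `D`: the infimum, over all `x, x' ∈ D` with
`⟨∇f(x), x' - x⟩ < 0`, of `(2 / γ²) (f(x') - f(x) - ⟨∇f(x), x' - x⟩)`, where `γ` is the step size
`awayStep f x x' s v` for a towards vertex `s` and a worst-case away vertex `v` at `x`. The value of
`γ` is the same for all such `s` and `v`, and on a polytope such `s` and `v` exist
(`exists_isTowardsVertex`, `exists_isWorstAwayVertex`). An infimum over the empty set is `+∞`. -/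
noncomputable def geomStrongConvexity (f : E → ℝ) (D : Set E) : EReal :=
  ⨅ (x ∈ D) (x' ∈ D) (_ : fderiv ℝ f x (x' - x) < 0)
    (s : E) (_ : IsTowardsVertex f D x s) (v : E) (_ : IsWorstAwayVertex f D x v),
    ((2 / awayStep f x x' s v ^ 2 * (f x' - f x - fderiv ℝ f x (x' - x)) : ℝ) : EReal)

end StrongConvexityConstant

section PyramidalWidth

variable {E : Type*} [NormedAddCommGroup E] [InnerProductSpace ℝ E]

/-- The dual norm of `d`, i.e. the norm of the linear form `⟪d, ·⟫`. -/
noncomputable def dualNorm (d : E) : ℝ := ‖innerSL ℝ d‖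

/-- The directional width of `T` in the direction `d`. (It is applied to finite nonempty sets `T`
only, for which the supremum and the infimum are a maximum and a minimum.) -/
noncomputable def dirWidth (T : Set E) (d : E) : ℝ :=
  sSup ((fun y => inner ℝ ((dualNorm d)⁻¹ • d) y) '' T) -
    sInf ((fun y => inner ℝ ((dualNorm d)⁻¹ • d) y) '' T)

/-- The set of maximizers of `⟪d, ·⟫` over `K`. -/
def maximizers (K : Set E) (d : E) : Set E :=
  {s ∈ K | ∀ y ∈ K, inner ℝ d y ≤ inner ℝ d s}

/-- The pyramidal directional width of `K` with respect to the direction `d` and the base point `x`: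
the smallest directional width of `S ∪ {s}` over the active sets `S` at `x`, with `s` a maximizer of
`⟪d, ·⟫` over `K`. -/
noncomputable def pyramidalDirWidth (K : Set E) (d x : E) : EReal :=
  ⨅ (S ∈ activeSets K x) (s ∈ maximizers K d), (dirWidth (insert s (S : Set E)) d : EReal)

/-- The cone of feasible directions of `K` from `x`: the conic hull of `K - x`. -/
def feasibleDirections (K : Set E) (x : E) : Set E :=
  (PointedCone.hull ℝ ((fun y => y - x) '' K) : Set E)

/-- The pyramidal width of `D`: the smallest pyramidal directional width of the faces `K` of `D`
(including `D` itself), over all base points `x` in `K` and nonzero feasible directions of `K`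
from `x`. An infimum over the empty set is `+∞`. -/
noncomputable def pyramidalWidth (D : Set E) : EReal :=
  ⨅ (K : Set E) (_ : IsExposed ℝ D K) (x ∈ K) (d ∈ feasibleDirections K x \ {0}),
    pyramidalDirWidth K d x

end PyramidalWidth

section Existence

variable {E : Type*} [NormedAddCommGroup E] [NormedSpace ℝ E] {D : Set E}

theorem IsPolytope.finite_extremePoints (hD : IsPolytope D) : (D.extremePoints ℝ).Finite := by
  obtain ⟨F, rfl⟩ := hD
  exact F.finite_toSet.subset extremePoints_convexHull_subset

theorem IsPolytope.eq_convexHull (hD : IsPolytope D) : D = convexHull ℝ (D.extremePoints ℝ) := by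
  have hf := hD.finite_extremePoints
  obtain ⟨F, hF⟩ := hD
  have hc : IsCompact D := by rw [hF]; exact F.finite_toSet.isCompact_convexHull (𝕜 := ℝ)
  have hv : Convex ℝ D := by rw [hF]; exact convex_convexHull ℝ _
  rw [← (hf.isClosed_convexHull (𝕜 := ℝ)).closure_eq, closure_convexHull_extremePoints hc hv]

theorem IsPolytope.activeSets_nonempty (hD : IsPolytope D) {x : E} (hx : x ∈ D) :
    (activeSets D x).Nonempty := by
  classical
  have hf := hD.finite_extremePoints
  rw [hD.eq_convexHull, ← hf.coe_toFinset, Finset.mem_convexHull'] at hx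
  obtain ⟨w, h0, h1, h2⟩ := hx
  refine ⟨hf.toFinset.filter (fun v => w v ≠ 0), ?_, w, ?_, ?_, ?_⟩
  · intro v hv
    simp only [Finset.coe_filter, Set.mem_ofPred_eq, Set.Finite.mem_toFinset] at hv
    exact hv.1
  · intro v hv
    rw [Finset.mem_filter] at hv
    exact lt_of_le_of_ne (h0 v hv.1) (Ne.symm hv.2)
  · rw [Finset.sum_filter_ne_zero, h1]
  · rw [Finset.sum_filter_of_ne, h2]
    intro v _ hv h
    simp [h] at hv

theorem exists_isTowardsVertex (f : E → ℝ) (hD : IsPolytope D) {x : E} (hx : x ∈ D) :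
    ∃ s, IsTowardsVertex f D x s := by
  have hne : (D.extremePoints ℝ).Nonempty := by
    rw [hD.eq_convexHull] at hx
    exact convexHull_nonempty_iff.1 ⟨x, hx⟩
  obtain ⟨s, hs, hmin⟩ := Set.exists_min_image _ (fderiv ℝ f x) hD.finite_extremePoints hne
  exact ⟨s, hs, hmin⟩

theorem exists_isWorstAwayVertex (f : E → ℝ) (hD : IsPolytope D) {x : E} (hx : x ∈ D) :
    ∃ v, IsWorstAwayVertex f D x v := by
  have hfin : {v | ∃ S ∈ activeSets D x, IsAwayVertexOf f x S v}.Finite :=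
    hD.finite_extremePoints.subset fun v ⟨S, hS, hv⟩ => hS.1 hv.1
  have hne : {v | ∃ S ∈ activeSets D x, IsAwayVertexOf f x S v}.Nonempty := by
    obtain ⟨S, hS⟩ := hD.activeSets_nonempty hx
    have hSne : S.Nonempty := by
      obtain ⟨w, -, h1, -⟩ := hS.2
      by_contra h
      rw [Finset.not_nonempty_iff_eq_empty.1 h] at h1
      simp at h1
    obtain ⟨v, hv, hmax⟩ := S.exists_max_image (fderiv ℝ f x) hSne
    exact ⟨v, S, hS, hv, hmax⟩
  obtain ⟨v, hv, hmin⟩ := Set.exists_min_image _ (fderiv ℝ f x) hfin hne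
  exact ⟨v, hv, fun S hS u hu => hmin u ⟨S, hS, hu⟩⟩

end Existence

end FrankWolfe

/-!
Put `ℓ = -∇f(x)`, as a linear form, and `e = x' - x`, so that `ℓ e > 0`. The heart of the matter is
the bound `PdirW(D) * ℓ e ≤ ‖e‖ * ℓ (v' - v)`, in the form `pyramidalWidth_le_of_forall_mem`, where
`v'` maximizes `ℓ` over `D` and `v` minimizes `ℓ` over an active set `S` at `x`. The strong
convexity inequality `f x' - f x - ∇f(x) e ≥ μ / 2 * ‖e‖ ^ 2` then gives the theorem
by algebra.

For the bound, `ℓ` need not be represented by a feasible direction, so it is projected onto the cone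
of feasible directions of `D` at `x`. The projection is a feasible direction `p` such that
`ℓ p = ⟪p, p⟫` and `ℓ (y - x) ≤ ⟪p, y - x⟫` for all `y ∈ D` (Moreau decomposition,
`exists_mem_hull_forall_le_inner`). The residual `n = ℓ - ⟪p, ·⟫` is therefore maximized over `D`
at `x`, and exposes a face `K` of `D` that contains `x`. As `n p = 0`, the direction `p` is already
feasible for `K` (`mem_hull_of_forall_nonpos`), and `S`, whose points average to the maximizer `x`
of `n`, lies in `K`. On `K` the forms `ℓ` and `⟪p, ·⟫` differ by a constant, so the pyramidal width
of `K` in the direction `p` bounds `ℓ (v' - v) / ‖p‖` from below, while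
`ℓ e ≤ ⟪p, e⟫ ≤ ‖p‖ * ‖e‖`.

The projection exists because a finitely generated cone is complete (`isComplete_hull_finset`): by
the conic form of Carathéodory's theorem it is a finite union of cones over linearly independent
sets, and each of these is the image of an orthant under an injective linear map. The ambient space
`E` need not be complete.
-/

namespace FrankWolfe

/-! ### Finitely generated cones -/

section Cone

/-- Conic form of **Carathéodory's theorem**: a conic combination of finitely many vectors is a
conic combination of linearly independent ones among them. -/
theorem exists_linearIndepOn_conic_combination {E : Type*} [AddCommGroup E] [Module ℝ E]
    (F : Finset E) (w : E → ℝ) (hw : ∀ v ∈ F, 0 ≤ w v) :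
    ∃ T ⊆ F, LinearIndepOn ℝ id (T : Set E) ∧
      ∃ u : E → ℝ, (∀ v ∈ T, 0 ≤ u v) ∧ ∑ v ∈ T, u v • v = ∑ v ∈ F, w v • v := by
  classical
  induction F using Finset.strongInduction generalizing w with
  | H F ih =>
    by_cases hF : LinearIndepOn ℝ id (F : Set E)
    · exact ⟨F, subset_rfl, hF, w, hw, rfl⟩
    obtain ⟨g, hg, hpos⟩ : ∃ g : E → ℝ, ∑ v ∈ F, g v • v = 0 ∧ ∃ v ∈ F, 0 < g v := by
      rw [linearIndepOn_finset_iff] at hF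
      push Not at hF
      obtain ⟨g, hg, i, hi, hgi⟩ := hF
      rcases lt_or_gt_of_ne hgi with h | h
      · refine ⟨-g, ?_, i, hi, by simpa using h⟩
        simpa [neg_smul, Finset.sum_neg_distrib] using hg
      · exact ⟨g, hg, i, hi, h⟩
    -- Subtract the largest multiple of the relation `g` that keeps all coefficients nonnegative.
    obtain ⟨i, hi, hmin⟩ := (F.filter (0 < g ·)).exists_min_image (fun v => w v / g v)
      (by obtain ⟨v, hv, h⟩ := hpos; exact ⟨v, Finset.mem_filter.2 ⟨hv, h⟩⟩)
    rw [Finset.mem_filter] at hi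
    have hr : 0 ≤ w i / g i := div_nonneg (hw i hi.1) hi.2.le
    obtain ⟨T, hT, hTi, u, hu, hsum⟩ := ih (F.erase i) (Finset.erase_ssubset hi.1)
      (fun v => w v - w i / g i * g v) (by
        intro v hv
        have hvF := Finset.mem_of_mem_erase hv
        rw [sub_nonneg]
        rcases lt_or_ge 0 (g v) with h | h
        · exact (le_div_iff₀ h).1 (hmin v (Finset.mem_filter.2 ⟨hvF, h⟩))
        · exact (mul_nonpos_of_nonneg_of_nonpos hr h).trans (hw v hvF))
    refine ⟨T, hT.trans (Finset.erase_subset _ _), hTi, u, hu, ?_⟩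
    rw [hsum, Finset.sum_erase _ (by rw [div_mul_cancel₀ _ hi.2.ne', sub_self, zero_smul])]
    simp only [sub_smul, mul_smul, Finset.sum_sub_distrib, ← Finset.smul_sum, hg, smul_zero,
      sub_zero]

theorem mem_hull_finset {E : Type*} [AddCommGroup E] [Module ℝ E] {F : Finset E} {x : E} :
    x ∈ PointedCone.hull ℝ (F : Set E) ↔
      ∃ w : E → ℝ, (∀ v ∈ F, 0 ≤ w v) ∧ ∑ v ∈ F, w v • v = x := by
  constructor
  · rw [PointedCone.mem_hull_set]
    rintro ⟨c, hc, h0, rfl⟩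
    refine ⟨c, fun v _ => h0 v, ?_⟩
    rw [Finsupp.sum_of_support_subset _ (by exact_mod_cast hc) _ (by simp)]
  · rintro ⟨w, hw, rfl⟩
    exact Submodule.sum_mem _ fun v hv =>
      PointedCone.smul_mem _ (hw v hv) (PointedCone.subset_hull hv)

variable {E : Type*} [NormedAddCommGroup E] [NormedSpace ℝ E]

theorem isClosed_hull_of_linearIndepOn {T : Finset E} (hT : LinearIndepOn ℝ id (T : Set E)) :
    IsClosed (PointedCone.hull ℝ (T : Set E) : Set E) := by
  classical
  let L : (T → ℝ) →ₗ[ℝ] E := Fintype.linearCombination ℝ (fun v : T => (v : E))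
  have hL : LinearMap.ker L = ⊥ := by
    exact LinearMap.ker_eq_bot.2 (linearIndependent_iff_injective_fintypeLinearCombination.1 hT)
  have himg : (PointedCone.hull ℝ (T : Set E) : Set E) = L '' Set.Ici 0 := by
    ext x
    rw [SetLike.mem_coe, mem_hull_finset]
    constructor
    · rintro ⟨w, hw, rfl⟩
      refine ⟨fun v => w v, fun v => hw v v.2, ?_⟩
      rw [Fintype.linearCombination_apply]
      exact T.sum_coe_sort (fun v => w v • v)
    · rintro ⟨w, hw, rfl⟩
      refine ⟨fun v => if h : v ∈ T then w ⟨v, h⟩ else 0, fun v hv => ?_, ?_⟩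
      · simpa [hv] using hw ⟨v, hv⟩
      · rw [Fintype.linearCombination_apply, ← T.sum_coe_sort]
        simp
  rw [himg]
  exact (LinearMap.isClosedEmbedding_of_injective hL).isClosedMap _ isClosed_Ici

theorem isClosed_hull_finset (F : Finset E) :
    IsClosed (PointedCone.hull ℝ (F : Set E) : Set E) := by
  have h : (PointedCone.hull ℝ (F : Set E) : Set E) =
      ⋃ T ∈ {T : Finset E | T ⊆ F ∧ LinearIndepOn ℝ id (T : Set E)},
        (PointedCone.hull ℝ (T : Set E) : Set E) := by
    ext x
    simp only [Set.mem_iUnion, SetLike.mem_coe, exists_prop]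
    constructor
    · intro hx
      obtain ⟨w, hw, rfl⟩ := mem_hull_finset.1 hx
      obtain ⟨T, hTF, hT, u, hu, hsum⟩ := exists_linearIndepOn_conic_combination F w hw
      exact ⟨T, ⟨hTF, hT⟩, mem_hull_finset.2 ⟨u, hu, hsum⟩⟩
    · rintro ⟨T, ⟨hTF, -⟩, hx⟩
      exact Submodule.span_mono (by exact_mod_cast hTF) hx
  rw [h]
  refine Set.Finite.isClosed_biUnion ?_ fun T hT => isClosed_hull_of_linearIndepOn hT.2
  exact F.powerset.finite_toSet.subset fun T hT => by simpa using hT.1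

theorem isComplete_hull_finset (F : Finset E) :
    IsComplete (PointedCone.hull ℝ (F : Set E) : Set E) := by
  have hV : IsComplete (Submodule.span ℝ (F : Set E) : Set E) :=
    Submodule.complete_of_finiteDimensional _
  intro l hl hlC
  have hsub : (PointedCone.hull ℝ (F : Set E) : Set E) ⊆ Submodule.span ℝ (F : Set E) :=
    PointedCone.hull_le_span ℝ (F : Set E)
  obtain ⟨z, -, hz⟩ := hV l hl (hlC.trans (Filter.principal_mono.2 hsub))
  have : l.NeBot := hl.1
  exact ⟨z, (isClosed_hull_finset F).mem_of_tendsto (f := id) (b := l) hz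
    (Filter.le_principal_iff.1 hlC), hz⟩

/-- If a linear form `n` is nonpositive on the generators of a cone, then its zeros in the cone are
generated by its zeros among the generators. -/
theorem mem_hull_of_forall_nonpos {A : Set E} (n : E →ₗ[ℝ] ℝ) (hn : ∀ a ∈ A, n a ≤ 0) {p : E}
    (hp : p ∈ PointedCone.hull ℝ A) (hnp : n p = 0) :
    p ∈ PointedCone.hull ℝ {a ∈ A | n a = 0} := by
  suffices h : n p ≤ 0 ∧ (n p = 0 → p ∈ PointedCone.hull ℝ {a ∈ A | n a = 0}) from h.2 hnp
  clear hnp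
  induction hp using Submodule.span_induction with
  | mem a ha => exact ⟨hn a ha, fun h => PointedCone.subset_hull ⟨ha, h⟩⟩
  | zero => exact ⟨(map_zero n).le, fun _ => Submodule.zero_mem _⟩
  | add a b _ _ iha ihb =>
    rw [map_add]
    exact ⟨add_nonpos iha.1 ihb.1, fun h => Submodule.add_mem _
      (iha.2 (by linarith [iha.1, ihb.1])) (ihb.2 (by linarith [iha.1, ihb.1]))⟩
  | smul t a _ iha =>
    have ht : n (t • a) = (t : ℝ) * n a := n.map_smul (t : ℝ) a
    rw [ht]
    refine ⟨mul_nonpos_of_nonneg_of_nonpos t.2 iha.1, fun h => ?_⟩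
    rcases mul_eq_zero.1 h with h | h
    · obtain rfl : t = 0 := Subtype.ext h
      rw [zero_smul]
      exact Submodule.zero_mem _
    · exact Submodule.smul_mem _ t (iha.2 h)

end Cone

section Projection

variable {E : Type*} [NormedAddCommGroup E] [InnerProductSpace ℝ E]

/-- The Moreau decomposition of a continuous linear form with respect to a finitely generated cone:
the form is the sum of `⟪p, ·⟫`, for some `p` in the cone, and of a form that is nonpositive on the
cone and vanishes at `p`. -/
theorem exists_mem_hull_forall_le_inner (F : Finset E) (ℓ : E →L[ℝ] ℝ) :
    ∃ p ∈ PointedCone.hull ℝ (F : Set E), ℓ p = inner ℝ p p ∧ ∀ a ∈ F, ℓ a ≤ inner ℝ p a := by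
  set C := PointedCone.hull ℝ (F : Set E) with hC
  -- On the finite-dimensional span of `F`, the form is represented by a vector `u`.
  let V := Submodule.span ℝ (F : Set E)
  let u : V := (InnerProductSpace.toDual ℝ V).symm (ℓ.comp V.subtypeL)
  have hu : ∀ c ∈ C, inner ℝ (u : E) c = ℓ c := fun c hc => by
    have hcV : c ∈ V := PointedCone.hull_le_span ℝ (F : Set E) hc
    exact InnerProductSpace.toDual_symm_apply (x := (⟨c, hcV⟩ : V)) (y := ℓ.comp V.subtypeL)
  obtain ⟨p, hp, hmin⟩ := exists_norm_eq_iInf_of_complete_convex ⟨0, C.zero_mem⟩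
    (isComplete_hull_finset F) C.convex (u : E)
  rw [norm_eq_iInf_iff_real_inner_le_zero C.convex hp] at hmin
  -- Testing the variational inequality at `0` and `p + p` gives `ℓ p = ⟪p, p⟫`.
  have h0 := hmin 0 C.zero_mem
  have h2 := hmin (p + p) (C.add_mem hp hp)
  simp only [inner_sub_left, inner_sub_right, inner_zero_right, inner_add_right, hu p hp]
    at h0 h2
  refine ⟨p, hp, by linarith, fun a ha => ?_⟩
  have haC : a ∈ C := PointedCone.subset_hull ha
  have h := hmin a haC
  simp only [inner_sub_left, inner_sub_right, hu p hp, hu a haC] at h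
  linarith

end Projection

/-! ### Directional widths -/

section Width

variable {E : Type*} [NormedAddCommGroup E] [InnerProductSpace ℝ E]

theorem dualNorm_eq_norm (d : E) : dualNorm d = ‖d‖ := innerSL_apply_norm ℝ d

theorem dirWidth_nonneg {T : Set E} (hT : T.Finite) (d : E) : 0 ≤ dirWidth T d :=
  sub_nonneg.2 (Real.sInf_le_sSup _ (hT.image _).bddBelow (hT.image _).bddAbove)

theorem dirWidth_le {T : Set E} (hT : T.Nonempty) {d : E} {a b : ℝ}
    (hb : ∀ y ∈ T, inner ℝ d y ≤ b) (ha : ∀ y ∈ T, a ≤ inner ℝ d y) :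
    dirWidth T d ≤ ‖d‖⁻¹ * (b - a) := by
  have hd : 0 ≤ ‖d‖⁻¹ := inv_nonneg.2 (norm_nonneg d)
  rw [dirWidth, dualNorm_eq_norm, mul_sub]
  refine sub_le_sub (csSup_le (hT.image _) ?_) (le_csInf (hT.image _) ?_)
  · rintro _ ⟨y, hy, rfl⟩
    simpa only [real_inner_smul_left] using mul_le_mul_of_nonneg_left (hb y hy) hd
  · rintro _ ⟨y, hy, rfl⟩
    simpa only [real_inner_smul_left] using mul_le_mul_of_nonneg_left (ha y hy) hd

theorem pyramidalWidth_nonneg (D : Set E) : 0 ≤ pyramidalWidth D := by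
  simp only [pyramidalWidth, pyramidalDirWidth, le_iInf_iff]
  intro K _ x _ d _ S _ s _
  exact_mod_cast dirWidth_nonneg (S.finite_toSet.insert s) d

theorem IsPolytope.isCompact {D : Set E} (hD : IsPolytope D) : IsCompact D := by
  obtain ⟨F, rfl⟩ := hD
  exact F.finite_toSet.isCompact_convexHull (𝕜 := ℝ)

/-- An active set at `x` lies in every face containing `x`: if `x` maximizes `n` over `D`, then so
does each point of an active set at `x`. -/
theorem eq_of_mem_activeSets {D : Set E} {x : E} {S : Finset E} (hS : S ∈ activeSets D x)
    (n : E →ₗ[ℝ] ℝ) (hn : ∀ y ∈ D, n y ≤ n x) {v : E} (hv : v ∈ S) : n v = n x := by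
  obtain ⟨hSD, w, hw, h1, hx⟩ := hS
  have hle : ∀ u ∈ S, w u * n u ≤ w u * n x := fun u hu =>
    mul_le_mul_of_nonneg_left (hn u (extremePoints_subset (hSD hu))) (hw u hu).le
  have hsum : ∑ u ∈ S, w u * n u = ∑ u ∈ S, w u * n x := by
    rw [← Finset.sum_mul, h1, one_mul]
    conv_rhs => rw [← hx]
    simp
  exact mul_left_cancel₀ (hw v hv).ne' ((Finset.sum_eq_sum_iff_of_le hle).1 hsum v hv)

/-- The pyramidal width of a polytope is a lower bound for the spread `b - a` of a linear form `ℓ`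
between its maximum over the polytope and its minimum over an active set at `x`, divided by the
slope of `ℓ` from `x` towards any point `y` of the polytope. The form is not assumed to be
represented by a feasible direction. -/
theorem pyramidalWidth_le_of_forall_mem {D : Set E} (hD : IsPolytope D) (ℓ : E →L[ℝ] ℝ)
    {x y : E} (hx : x ∈ D) (hy : y ∈ D) (hpos : 0 < ℓ (y - x)) {S : Finset E}
    (hS : S ∈ activeSets D x) {a b : ℝ} (ha : ∀ u ∈ S, a ≤ ℓ u) (hb : ∀ u ∈ D, ℓ u ≤ b) :
    pyramidalWidth D ≤ ((‖y - x‖ * (b - a) / ℓ (y - x) : ℝ) : EReal) := by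
  classical
  obtain ⟨F, hF⟩ := id hD
  have hFD : (F : Set E) ⊆ D := hF ▸ subset_convexHull ℝ _
  obtain ⟨p, hp, hpp, hle⟩ := exists_mem_hull_forall_le_inner (F.image (· - x)) ℓ
  -- The residual form `n` exposes the face `K`.
  let n : StrongDual ℝ E := ℓ - innerSL ℝ p
  have hn_apply : ∀ z, n z = ℓ z - inner ℝ p z := fun z => rfl
  have hn : ∀ z ∈ D, n z ≤ n x := by
    rw [hF]
    refine fun z hz => convexHull_min (t := {z | n z ≤ n x}) (fun z hz => ?_)
      (convex_halfSpace_le n.toLinearMap.isLinear (n x)) hz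
    have h := hle (z - x) (Finset.mem_image_of_mem _ hz)
    rw [map_sub, inner_sub_right] at h
    simp only [Set.mem_ofPred_eq, hn_apply]
    linarith
  let K : Set E := {z ∈ D | ∀ y ∈ D, n y ≤ n z}
  have hKx : ∀ {z}, z ∈ D → n z = n x → z ∈ K := fun hz h => ⟨hz, fun y hy => h ▸ hn y hy⟩
  have hnK : ∀ z ∈ K, n z = n x := fun z hz => le_antisymm (hn z hz.1) (hz.2 x hx)
  have hxK : x ∈ K := hKx hx rfl
  have hexp : IsExposed ℝ D K := fun _ => ⟨n, rfl⟩
  have hKcpt : IsCompact K := hexp.isCompact hD.isCompact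
  have hSK : ∀ u ∈ S, u ∈ K := fun u hu => hKx (extremePoints_subset (hS.1 hu))
    (eq_of_mem_activeSets hS n.toLinearMap hn hu)
  have hSact : S ∈ activeSets K x := ⟨fun u hu =>
    inter_extremePoints_subset_extremePoints_of_subset (fun z hz => hz.1) ⟨hSK u hu, hS.1 hu⟩,
    hS.2⟩
  have hpfeas : p ∈ feasibleDirections K x := by
    have hnle : ∀ c ∈ ((F.image (· - x) : Finset E) : Set E), n c ≤ 0 := fun c hc => by
      rw [hn_apply, sub_nonpos]
      exact hle c (Finset.mem_coe.1 hc)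
    have hnp : n p = 0 := by rw [hn_apply, hpp, sub_self]
    have h := mem_hull_of_forall_nonpos n.toLinearMap hnle hp hnp
    refine Submodule.span_mono (R := NNReal) ?_ h
    rintro _ ⟨hc, h0⟩
    obtain ⟨z, hz, rfl⟩ := Finset.mem_image.1 hc
    refine ⟨z, hKx (hFD hz) ?_, rfl⟩
    have h0' : n (z - x) = 0 := h0
    rwa [map_sub, sub_eq_zero] at h0'
  have hℓp : ℓ (y - x) ≤ ‖p‖ * ‖y - x‖ := by
    refine le_trans ?_ (real_inner_le_norm p (y - x))
    have h := hn y hy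
    rw [← sub_nonpos, ← map_sub, hn_apply] at h
    linarith
  have hp0 : p ≠ 0 := by
    rintro rfl
    rw [norm_zero, zero_mul] at hℓp
    exact absurd hpos hℓp.not_gt
  obtain ⟨s, hsK, hs⟩ := hKcpt.exists_isMaxOn ⟨x, hxK⟩
    (f := fun z => (inner ℝ p z : ℝ)) (by fun_prop)
  have hsmax : s ∈ maximizers K p := ⟨hsK, hs⟩
  -- On `K` the forms `ℓ` and `⟪p, ·⟫` differ by the constant `n x`.
  have hinner : ∀ z ∈ K, inner ℝ p z = ℓ z - n x := fun z hz => by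
    rw [← hnK z hz, hn_apply, sub_sub_cancel]
  have hSne : S.Nonempty := by
    obtain ⟨-, w, -, h1, -⟩ := hS
    by_contra h
    rw [Finset.not_nonempty_iff_eq_empty.1 h, Finset.sum_empty] at h1
    exact zero_ne_one h1
  have has : a ≤ ℓ s := by
    obtain ⟨u, hu⟩ := hSne
    have h := hsmax.2 u (hSK u hu)
    rw [hinner u (hSK u hu), hinner s hsK] at h
    linarith [ha u hu]
  have hT : ∀ z ∈ insert s (S : Set E), z ∈ K ∧ a ≤ ℓ z := by
    rintro z (rfl | hz)
    · exact ⟨hsK, has⟩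
    · exact ⟨hSK z hz, ha z hz⟩
  have hw : dirWidth (insert s (S : Set E)) p ≤ ‖p‖⁻¹ * ((b - n x) - (a - n x)) := by
    refine dirWidth_le (Set.insert_nonempty _ _) (fun z hz => ?_) (fun z hz => ?_)
    · rw [hinner z (hT z hz).1]
      linarith [hb z (hT z hz).1.1]
    · rw [hinner z (hT z hz).1]
      linarith [(hT z hz).2]
  have hPW : pyramidalWidth D ≤ (dirWidth (insert s (S : Set E)) p : EReal) :=
    (iInf₂_le_of_le K hexp <| iInf₂_le_of_le x hxK <|
      iInf₂_le_of_le p ⟨hpfeas, hp0⟩ <| iInf₂_le_of_le S hSact <| iInf₂_le s hsmax)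
  refine hPW.trans (EReal.coe_le_coe_iff.2 (hw.trans ?_))
  have hab : 0 ≤ b - a := sub_nonneg.2 (has.trans (hb s hsK.1))
  have hpn : 0 < ‖p‖ := norm_pos_iff.2 hp0
  rw [sub_sub_sub_cancel_right, inv_mul_eq_div, div_le_div_iff₀ hpn hpos]
  nlinarith [mul_le_mul_of_nonneg_left hℓp hab]

end Width

/-! ### Strong convexity -/

/-- The first-order lower bound for a strongly convex function. -/
theorem le_sub_sub_fderiv_of_strongConvexOn {E : Type*} [NormedAddCommGroup E] [NormedSpace ℝ E]
    {D : Set E} {f : E → ℝ} {μ : ℝ} (hf : StrongConvexOn D μ f) {x y : E} (hx : x ∈ D)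
    (hy : y ∈ D) (hfx : DifferentiableAt ℝ f x) :
    μ / 2 * ‖y - x‖ ^ 2 ≤ f y - f x - fderiv ℝ f x (y - x) := by
  have hline : Filter.Tendsto (fun t : ℝ => t⁻¹ • (f (x + t • (y - x)) - f x))
      (nhdsWithin 0 (Set.Ioi 0)) (nhds (fderiv ℝ f x (y - x))) :=
    (hfx.hasFDerivAt.hasLineDerivAt (y - x)).tendsto_slope_zero_right
  have hbound : Filter.Tendsto (fun t : ℝ => f y - f x - (1 - t) * (μ / 2 * ‖y - x‖ ^ 2))
      (nhdsWithin 0 (Set.Ioi 0)) (nhds (f y - f x - (1 - 0) * (μ / 2 * ‖y - x‖ ^ 2))) :=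
    (Continuous.tendsto (by fun_prop) 0).mono_left nhdsWithin_le_nhds
  have hle := le_of_tendsto_of_tendsto hline hbound (by
    filter_upwards [Ioo_mem_nhdsGT (zero_lt_one' ℝ)] with t ht
    have h := hf.2 hx hy (sub_nonneg.2 ht.2.le) ht.1.le (sub_add_cancel 1 t)
    have hpt : (1 - t) • x + t • y = x + t • (y - x) := by
      rw [sub_smul, one_smul, smul_sub]; abel
    rw [hpt, norm_sub_rev] at h
    rw [smul_eq_mul, inv_mul_le_iff₀ ht.1]
    simp only [smul_eq_mul] at h
    linarith)
  linarith

end FrankWolfe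

theorem mainTheorem3 {E : Type*} [NormedAddCommGroup E] [InnerProductSpace ℝ E]
    (D : Set E) (hD : FrankWolfe.IsPolytope D)
    (f : E → ℝ) (hfd : ∀ x ∈ D, DifferentiableAt ℝ f x)
    (μ : ℝ) (hμ : 0 ≤ μ) (hf : StrongConvexOn D μ f) :
    (μ : EReal) * FrankWolfe.pyramidalWidth D ^ 2 ≤ FrankWolfe.geomStrongConvexity f D := by
  simp only [FrankWolfe.geomStrongConvexity, le_iInf_iff]
  intro x hx y hy hneg s hs v hv
  obtain ⟨S, hS, hvS⟩ := hv.1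
  set e := y - x
  set g := fderiv ℝ f x with hg
  -- The towards vertex minimizes the derivative over all of `D`, not only over the vertices.
  have hsD : ∀ u ∈ D, g s ≤ g u := by
    rw [hD.eq_convexHull]
    exact fun u hu => convexHull_min (t := {u | g s ≤ g u}) hs.2
      (convex_halfSpace_ge g.toLinearMap.isLinear (g s)) hu
  have hPW := FrankWolfe.pyramidalWidth_le_of_forall_mem hD (-g) hx hy (neg_pos.2 hneg) hS
    (a := -g v) (b := -g s) (fun u hu => neg_le_neg (hvS.2 u hu))
    (fun u hu => neg_le_neg (hsD u hu))
  set w : ℝ := ‖y - x‖ * (-g s - -g v) / (-g) (y - x) with hw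
  have hstrong := FrankWolfe.le_sub_sub_fderiv_of_strongConvexOn hf hx hy (hfd x hx)
  have hreal : μ * w ^ 2 ≤ 2 / FrankWolfe.awayStep f x y s v ^ 2 * (f y - f x - g e) := by
    have hwγ : μ * w ^ 2 = 2 / FrankWolfe.awayStep f x y s v ^ 2 * (μ / 2 * ‖e‖ ^ 2) := by
      have hw' : w = ‖e‖ * (FrankWolfe.awayStep f x y s v)⁻¹ := by
        rw [hw, FrankWolfe.awayStep, inv_div, ← hg, mul_div_assoc, neg_apply, ← neg_sub',
          neg_div_neg_eq, map_sub g s v]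
      rw [hw', mul_pow, inv_pow]
      ring
    rw [hwγ]
    exact mul_le_mul_of_nonneg_left hstrong (by positivity)
  calc (μ : EReal) * FrankWolfe.pyramidalWidth D ^ 2
      ≤ (μ : EReal) * (w : EReal) ^ 2 := by
        refine mul_le_mul_of_nonneg_left ?_ (EReal.coe_nonneg.2 hμ)
        exact pow_le_pow_left₀ (FrankWolfe.pyramidalWidth_nonneg D) hPW 2
    _ = ((μ * w ^ 2 : ℝ) : EReal) := by norm_cast
    _ ≤ _ := EReal.coe_le_coe_iff.2 hreal
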